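/- Let $p$ be a prime, let $n\ge 0$ be an integer, and let $\mathcal F$ be a family of subsets of $[n]=\{1,\dots,n\}$ that is $p$-wise $p$-divisible, meaning that $|A_1\cap\cdots\cap A_p|$ is divisible by $p$ for any (not necessarily distinct) $A_1,\dots,A_p\in\mathcal F$. Then $|\mathcal F|\le 2^{\lfloor n/p\rfloor}$. -/

import Mathlib

/-- A family `F` of subsets of an `n`-element set is `k`-wise `l`-divisible if
`|A 0 ∩ ⋯ ∩ A (k - 1)|` is divisible by `l` for any members `A 0, …, A (k - 1)` of `F`,
which need not be distinct. -/
def KWiseDivisible {n : ℕ} (k l : ℕ) (F : Finset (Finset (Fin n))) : Prop :=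
  ∀ A : Fin k → Finset (Fin n), (∀ i, A i ∈ F) → l ∣ (Finset.univ.inf A).card

/-!
Let `K` be an infinite field of characteristic `p` and let `V ⊆ K ^ n` be the span of the indicator
vectors of the members of `F`, under the coordinatewise product. Divisibility says that the sum of
the coordinates vanishes on `V ^ p`. Put `U = 1 + V`; since `V` is spanned by idempotents,
`V ^ p = V * U ^ (p - 1)`, so `V` and `U ^ (p - 1)` are orthogonal and
`dim V + dim U ^ (p - 1) ≤ n`.

A linear version of Kneser's theorem bounds `dim U ^ (p - 1)` from below by
`(p - 1) (dim U - dim H)`, where `H` is the subalgebra stabilizing `U ^ (p - 1)`. If `H = K`,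
this forces `dim V ≤ n / p` (when `1 ∈ V` one also needs `p ∣ n`, which holds because the coordinate
sum of `1` vanishes), and a `d`-dimensional space contains at most `2 ^ d` zero-one vectors.
Otherwise `H` contains the indicator of a nontrivial set `S` of coordinates, the coordinate sum
vanishes on `V ^ p` separately over `S` and over its complement, and induction applies to both
restrictions.
-/

open Module
open scoped Pointwise

section MulStabilizer

variable {K A : Type*} [CommSemiring K] [CommSemiring A] [Algebra K A]

/-- The subalgebra of all `a : A` with `a W ⊆ W`, the analogue for subspaces of the stabilizer of a
sumset in Kneser's theorem. -/
def mulStabilizer (W : Submodule K A) : Subalgebra K A :=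
  (W / W).toSubalgebra (Submodule.one_mem_div.2 le_rfl) fun a b ha hb w hw ↦ by
    simpa only [smul_eq_mul, mul_assoc] using ha (b * w) (hb w hw)

lemma le_mulStabilizer_iff {V W : Submodule K A} :
    V ≤ (mulStabilizer W).toSubmodule ↔ V * W ≤ W :=
  Submodule.le_div_iff_mul_le

lemma mulStabilizer_le_mulStabilizer_mul (V W : Submodule K A) :
    mulStabilizer V ≤ mulStabilizer (V * W) := by
  have h : (mulStabilizer V).toSubmodule * (V * W) ≤ V * W := by
    rw [← mul_assoc]
    exact mul_le_mul_left (le_mulStabilizer_iff.1 le_rfl) W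
  exact le_mulStabilizer_iff.2 h

lemma mem_units_inv_smul_iff {u : Aˣ} {W : Submodule K A} {a : A} : a ∈ u⁻¹ • W ↔ u * a ∈ W :=
  Set.mem_inv_smul_set_iff (A := (W : Set A)) (a := u) (x := a)

lemma dyson_transform_mul_le (V W : Submodule K A) (u : Aˣ) :
    (V ⊓ u⁻¹ • W) * (W ⊔ u • V) ≤ V * W := by
  rw [Submodule.mul_sup]
  refine sup_le (mul_le_mul_left inf_le_left W) ?_
  calc (V ⊓ u⁻¹ • W) * u • V ≤ u⁻¹ • W * u • V := mul_le_mul_left inf_le_right _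
    _ = V * W := by rw [smul_mul_assoc, mul_smul_comm, inv_smul_smul, mul_comm]

end MulStabilizer

section Kneser

variable {K A : Type*} [Field K] [CommRing A] [Algebra K A]

lemma finrank_units_smul (u : Aˣ) (V : Submodule K A) : finrank K ↥(u • V) = finrank K V :=
  LinearEquiv.finrank_map_eq (DistribMulAction.toLinearEquiv K A u) V

lemma exists_le_of_forall_isUnit_mem [Infinite K] [Finite (MaximalSpectrum A)] {ι : Type*}
    [Finite ι] {V : Submodule K A} (h1V : 1 ≤ V) (Y : ι → Submodule K A)
    (hY : ∀ v ∈ V, IsUnit v → ∃ j, v ∈ Y j) : ∃ j, V ≤ Y j := by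
  let Z : MaximalSpectrum A ⊕ ι → Submodule K A :=
    Sum.elim (fun m ↦ m.asIdeal.restrictScalars K) Y
  have hcover : ⋃ a, ((Z a).comap V.subtype : Set V) = Set.univ := by
    refine Set.eq_univ_of_forall fun v ↦ Set.mem_iUnion.2 ?_
    by_cases hv : IsUnit (v : A)
    · obtain ⟨j, hj⟩ := hY v v.2 hv
      exact ⟨.inr j, hj⟩
    · obtain ⟨m, hm, hvm⟩ := exists_max_ideal_of_mem_nonunits hv
      exact ⟨.inl ⟨m, hm⟩, hvm⟩
  obtain ⟨m | j, h⟩ := Subspace.exists_eq_top_of_iUnion_eq_univ hcover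
  · have h1m : (1 : A) ∈ m.asIdeal :=
      Submodule.comap_subtype_eq_top.1 h (Submodule.one_le.1 h1V)
    exact absurd h1m ((Ideal.ne_top_iff_one _).1 m.isMaximal.ne_top)
  · exact ⟨j, Submodule.comap_subtype_eq_top.1 h⟩

variable [FiniteDimensional K A]

lemma finrank_dyson_transform (V W : Submodule K A) (u : Aˣ) :
    finrank K ↥(V ⊓ u⁻¹ • W) + finrank K ↥(W ⊔ u • V) = finrank K V + finrank K W := by
  have hinf : u • (V ⊓ u⁻¹ • W) = W ⊓ u • V := by
    calc u • (V ⊓ u⁻¹ • W) = u • V ⊓ u • u⁻¹ • W := Submodule.map_inf _ (MulAction.injective u)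
      _ = W ⊓ u • V := by rw [smul_inv_smul, inf_comm]
  rw [← finrank_units_smul u, hinf, add_comm, Submodule.finrank_sup_add_finrank_inf_eq,
    finrank_units_smul, add_comm]

variable [Infinite K]

lemma exists_subalgebra_finrank_add_le (V W : Submodule K A) (h1V : 1 ≤ V) (h1W : 1 ≤ W) :
    ∃ H : Subalgebra K A, H.toSubmodule * W ≤ V * W ∧
      finrank K V + finrank K W ≤ finrank K ↥(V * W) + finrank K H := by
  have : IsArtinianRing A := .of_finite K A
  induction hd : finrank K V using Nat.strong_induction_on generalizing V W with
  | _ d ih =>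
  subst hd
  have hW : W ≤ V * W := le_mul_of_one_le_left' h1V
  by_cases hunit : ∀ w ∈ W, IsUnit w → w ∈ W / V
  · obtain ⟨-, hWV⟩ := exists_le_of_forall_isUnit_mem h1W (fun _ : Unit ↦ W / V)
      fun w hw hwu ↦ ⟨(), hunit w hw hwu⟩
    have hVW : V * W ≤ W := mul_comm V W ▸ Submodule.le_div_iff_mul_le.1 hWV
    refine ⟨mulStabilizer W, (le_mulStabilizer_iff.1 le_rfl).trans hW, ?_⟩
    rw [add_comm]
    exact add_le_add (Submodule.finrank_mono hW)
      (Submodule.finrank_mono (le_mulStabilizer_iff.2 hVW))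
  · push Not at hunit
    obtain ⟨_, huW, ⟨u, rfl⟩, huV⟩ := hunit
    have hlt : V ⊓ u⁻¹ • W < V :=
      inf_lt_left.2 fun h ↦ huV fun v hv ↦ mem_units_inv_smul_iff.1 (h hv)
    have h1V' : 1 ≤ V ⊓ u⁻¹ • W :=
      le_inf h1V (Submodule.one_le.2 (mem_units_inv_smul_iff.2 (by rwa [mul_one])))
    obtain ⟨H, hH, hdim⟩ := ih _ (Submodule.finrank_lt_finrank_of_lt hlt) (V ⊓ u⁻¹ • W)
      (W ⊔ u • V) h1V' (h1W.trans le_sup_left) rfl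
    have hmul := dyson_transform_mul_le V W u
    refine ⟨H, (mul_le_mul_right le_sup_left _).trans (hH.trans hmul), ?_⟩
    rw [← finrank_dyson_transform V W u]
    exact hdim.trans (Nat.add_le_add_right (Submodule.finrank_mono hmul) _)

lemma exists_subalgebra_finrank_add_le_of_unit_mem (V W : Submodule K A) (h1W : 1 ≤ W) {u : Aˣ}
    (hu : (u : A) ∈ V) :
    ∃ H : Subalgebra K A, u • (H.toSubmodule * W) ≤ V * W ∧
      finrank K V + finrank K W ≤ finrank K ↥(V * W) + finrank K H := by
  have h1V : 1 ≤ u⁻¹ • V :=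
    Submodule.one_le.2 (mem_units_inv_smul_iff.2 (by rwa [mul_one]))
  obtain ⟨H, hH, hdim⟩ := exists_subalgebra_finrank_add_le (u⁻¹ • V) W h1V h1W
  rw [smul_mul_assoc] at hH hdim
  rw [finrank_units_smul, finrank_units_smul] at hdim
  refine ⟨H, ?_, hdim⟩
  calc u • (H.toSubmodule * W) ≤ u • u⁻¹ • (V * W) := Submodule.map_mono hH
    _ = V * W := smul_inv_smul u _

/-- Covering `V` by the nonunits and by the subspaces `(V W) / (H W)`, with `H` as in
`exists_subalgebra_finrank_add_le_of_unit_mem`, makes a single `H` serve all of `V`. -/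
theorem finrank_add_finrank_le_finrank_mul_add_finrank_mulStabilizer [Finite (Subalgebra K A)]
    (V W : Submodule K A) (h1V : 1 ≤ V) (h1W : 1 ≤ W) :
    finrank K V + finrank K W ≤ finrank K ↥(V * W) + finrank K (mulStabilizer (V * W)) := by
  have : IsArtinianRing A := .of_finite K A
  let 𝓗 := {H : Subalgebra K A //
    finrank K V + finrank K W ≤ finrank K ↥(V * W) + finrank K H}
  obtain ⟨⟨H, hH⟩, hV⟩ := exists_le_of_forall_isUnit_mem h1V
    (fun H : 𝓗 ↦ (V * W) / (H.1.toSubmodule * W)) <| by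
    rintro _ huV ⟨u, rfl⟩
    obtain ⟨H, hHW, hH⟩ := exists_subalgebra_finrank_add_le_of_unit_mem V W h1W huV
    exact ⟨⟨H, hH⟩, fun x hx ↦ hHW (Submodule.smul_mem_pointwise_smul x u _ hx)⟩
  have hstab : H.toSubmodule ≤ (mulStabilizer (V * W)).toSubmodule :=
    le_mulStabilizer_iff.2 <|
      (mul_left_comm _ _ _).trans_le (Submodule.le_div_iff_mul_le.1 hV)
  exact hH.trans (Nat.add_le_add_left (Submodule.finrank_mono hstab) _)

theorem mul_finrank_le_finrank_pow_add [Finite (Subalgebra K A)] {U : Submodule K A} (h1U : 1 ≤ U)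
    (m : ℕ) :
    m * finrank K U ≤ finrank K ↥(U ^ m) + m * finrank K (mulStabilizer (U ^ m)) := by
  induction m with
  | zero => simp
  | succ m ih =>
    have hkneser := finrank_add_finrank_le_finrank_mul_add_finrank_mulStabilizer (U ^ m) U
      (one_le_pow_of_one_le' h1U m) h1U
    have hstab : finrank K (mulStabilizer (U ^ m)) ≤ finrank K (mulStabilizer (U ^ m * U)) :=
      Submodule.finrank_mono (Subalgebra.toSubmodule.monotone
        (mulStabilizer_le_mulStabilizer_mul (U ^ m) U))
    have hmul := Nat.mul_le_mul_left m hstab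
    rw [pow_succ, add_mul, add_mul, one_mul, one_mul]
    omega

end Kneser

section FunctionAlgebra

variable {ι K : Type*} [Finite ι] [Field K]

/-- By Lagrange interpolation, `g ∘ v` is a polynomial in `v`. -/
lemma comp_mem_subalgebra {H : Subalgebra K (ι → K)} {v : ι → K} (hv : v ∈ H) (g : K → K) :
    g ∘ v ∈ H := by
  classical
  let s : Finset K := (Set.finite_range v).toFinset
  have hg : Polynomial.aeval v (Lagrange.interpolate s id g) = g ∘ v := by
    ext i
    rw [Polynomial.aeval_pi_apply₂, Polynomial.coe_aeval_eq_eval]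
    exact Lagrange.eval_interpolate_at_node g Function.injective_id.injOn (i := v i) (by simp [s])
  exact hg ▸ Algebra.adjoin_le (Set.singleton_subset_iff.2 hv)
    (Polynomial.aeval_mem_adjoin_singleton K v)

lemma indicator_preimage_mem_subalgebra {H : Subalgebra K (ι → K)} {v : ι → K} (hv : v ∈ H)
    (s : Set K) : (v ⁻¹' s).indicator 1 ∈ H :=
  comp_mem_subalgebra hv (s.indicator 1)

lemma subalgebra_le_of_indicator_mem {H H' : Subalgebra K (ι → K)}
    (h : ∀ S : Set ι, S.indicator 1 ∈ H → S.indicator 1 ∈ H') : H ≤ H' := by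
  classical
  intro v hv
  have hdecomp : ∑ c ∈ (Set.finite_range v).toFinset, c • (v ⁻¹' {c}).indicator 1 = v := by
    ext i
    simp [Finset.sum_apply, Set.indicator_apply]
  rw [← hdecomp]
  exact H'.sum_mem fun c _ ↦ H'.smul_mem (h _ (indicator_preimage_mem_subalgebra hv {c})) c

instance finite_subalgebra_pi : Finite (Subalgebra K (ι → K)) := by
  refine Finite.of_injective (fun H ↦ {S : Set ι | S.indicator 1 ∈ H}) fun H H' h ↦ ?_
  exact le_antisymm (subalgebra_le_of_indicator_mem h.le) (subalgebra_le_of_indicator_mem h.ge)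

lemma exists_indicator_mem_of_subalgebra_ne_bot {H : Subalgebra K (ι → K)} (hH : H ≠ ⊥) :
    ∃ S : Set ι, S.Nonempty ∧ S ≠ Set.univ ∧ S.indicator 1 ∈ H := by
  by_contra! hcon
  refine hH (eq_bot_iff.2 (subalgebra_le_of_indicator_mem fun S hS ↦ ?_))
  obtain rfl | hne := S.eq_empty_or_nonempty
  · simp only [Set.indicator_empty']
    exact zero_mem _
  · obtain rfl : S = Set.univ := by_contra fun huniv ↦ hcon S hne huniv hS
    simp only [Set.indicator_univ, one_mem]

end FunctionAlgebra

section ZeroOne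

variable {ι K : Type*} [Field K]

/-- An information set of the linear code `V`. -/
lemma exists_card_le_finrank_eq_zero_of_forall_mem [Finite ι] (V : Submodule K (ι → K)) :
    ∃ s : Finset ι, s.card ≤ finrank K V ∧ ∀ v ∈ V, (∀ i ∈ s, v i = 0) → v = 0 := by
  classical
  let φ : ι → Dual K V := fun i ↦ LinearMap.proj i ∘ₗ V.subtype
  obtain ⟨κ, a, -, hspan, hli⟩ := exists_linearIndependent' K φ
  have : Finite κ := hli.finite
  have : Fintype κ := .ofFinite κ
  refine ⟨Finset.univ.image a, ?_, fun v hv h ↦ ?_⟩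
  · calc (Finset.univ.image a).card ≤ Fintype.card κ := Finset.card_image_le
      _ ≤ finrank K (Dual K V) := hli.fintype_card_le_finrank
      _ = finrank K V := Subspace.dual_finrank_eq
  · have hle : Submodule.span K (Set.range φ) ≤ LinearMap.ker (Dual.eval K V ⟨v, hv⟩) := by
      rw [← hspan, Submodule.span_le]
      rintro _ ⟨k, rfl⟩
      exact h (a k) (Finset.mem_image_of_mem a (Finset.mem_univ k))
    exact funext fun i ↦ hle (Submodule.subset_span ⟨i, rfl⟩)

lemma card_le_card_pow_finrank [Finite ι] {V : Submodule K (ι → K)} {F : Finset (ι → K)}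
    (hFV : ∀ f ∈ F, f ∈ V) {C : Finset K} (hC : C.Nonempty) (hFC : ∀ f ∈ F, ∀ i, f i ∈ C) :
    F.card ≤ C.card ^ finrank K V := by
  classical
  obtain ⟨s, hs, hsV⟩ := exists_card_le_finrank_eq_zero_of_forall_mem V
  let restr : (ι → K) → s → K := s.restrict
  have hmaps : Set.MapsTo restr F (Fintype.piFinset fun _ : s ↦ C) := fun f hf ↦
    Finset.mem_coe.2 (Fintype.mem_piFinset.2 fun i ↦ hFC f hf i)
  have hinj : Set.InjOn restr F := fun f hf g hg hfg ↦
    sub_eq_zero.1 <| hsV _ (V.sub_mem (hFV f hf) (hFV g hg)) fun i hi ↦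
      sub_eq_zero.2 (congrFun hfg ⟨i, hi⟩)
  calc F.card ≤ (Fintype.piFinset fun _ : s ↦ C).card := Finset.card_le_card_of_injOn _ hmaps hinj
    _ = C.card ^ s.card := by simp
    _ ≤ C.card ^ finrank K V := Nat.pow_le_pow_right hC.card_pos hs

lemma card_le_two_pow_finrank_span [Finite ι] {F : Finset (ι → K)}
    (hF : ∀ f ∈ F, IsIdempotentElem f) :
    F.card ≤ 2 ^ finrank K (Submodule.span K (F : Set (ι → K))) := by
  classical
  have hF01 : ∀ f ∈ F, ∀ i, f i ∈ ({0, 1} : Finset K) := fun f hf i ↦ by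
    simpa using IsIdempotentElem.iff_eq_zero_or_one.1 (congrFun (hF f hf) i)
  rw [← Finset.card_pair (zero_ne_one' K)]
  exact card_le_card_pow_finrank (fun f hf ↦ Submodule.subset_span hf) (by simp) hF01

lemma finrank_add_finrank_le_card_of_sum_eq_zero [Fintype ι] {V W : Submodule K (ι → K)}
    (h : ∀ x ∈ V * W, ∑ i, x i = 0) : finrank K V + finrank K W ≤ Fintype.card ι := by
  classical
  have hle : V.map (dotProductEquiv K ι).toLinearMap ≤ W.dualAnnihilator := by
    rintro _ ⟨v, hv, rfl⟩
    exact (Submodule.mem_dualAnnihilator _).2 fun w hw ↦ h _ (Submodule.mul_mem_mul hv hw)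
  calc finrank K V + finrank K W
      = finrank K (V.map (dotProductEquiv K ι).toLinearMap) + finrank K W := by
        rw [LinearEquiv.finrank_map_eq]
    _ ≤ finrank K W.dualAnnihilator + finrank K W :=
        Nat.add_le_add_right (Submodule.finrank_mono hle) _
    _ = Fintype.card ι := by
        rw [add_comm, Subspace.finrank_add_finrank_dualAnnihilator_eq,
          finrank_fintype_fun_eq_card]

end ZeroOne

section CoordinateSum

variable {ι K : Type*} [Fintype ι] [CommSemiring K]

lemma sum_eq_zero_of_mem_span_pow {F : Set (ι → K)} {m : ℕ}
    (hF : ∀ f : Fin m → ι → K, (∀ k, f k ∈ F) → ∑ i, ∏ k, f k i = 0) {x : ι → K}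
    (hx : x ∈ Submodule.span K F ^ m) : ∑ i, x i = 0 := by
  rw [Submodule.span_pow] at hx
  induction hx using Submodule.span_induction with
  | mem x hx =>
    obtain ⟨f, rfl⟩ := Set.mem_pow.1 hx
    simpa only [List.prod_ofFn, Finset.prod_apply] using hF (fun k ↦ f k) fun k ↦ (f k).2
  | zero => simp
  | add x y _ _ hx hy => simp only [Pi.add_apply, Finset.sum_add_distrib, hx, hy, add_zero]
  | smul c x _ hx => simp only [Pi.smul_apply, ← Finset.smul_sum, hx, smul_zero]

lemma sum_coe_eq_zero_of_indicator_mem {X : Submodule K (ι → K)}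
    (hX : ∀ x ∈ X, ∑ i, x i = 0) {S : Set ι} [Fintype S] (hS : S.indicator 1 ∈ mulStabilizer X)
    {x : ι → K} (hx : x ∈ X) : ∑ i : S, x i = 0 := by
  classical
  calc ∑ i : S, x i = ∑ i ∈ S.toFinset, x i := Finset.sum_set_coe S
    _ = ∑ i, (S.indicator (1 : ι → K) * x) i := by
        simp [Set.indicator_apply, Finset.sum_ite, Set.filter_mem_univ_eq_toFinset]
    _ = 0 := hX _ (hS x hx)

lemma sum_eq_zero_of_mem_span_image_domRestrict_pow {F : Set (ι → K)} {m : ℕ}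
    (hF : ∀ x ∈ Submodule.span K F ^ m, ∑ i, x i = 0) {S : Set ι} [Fintype S]
    (hS : S.indicator 1 ∈ mulStabilizer (Submodule.span K F ^ m)) :
    ∀ x ∈ Submodule.span K (S.domRestrict '' F) ^ m, ∑ i, x i = 0 := by
  let ρ : (ι → K) →ₐ[K] S → K := AlgHom.pi fun i ↦ Pi.evalAlgHom K (fun _ ↦ K) i.1
  have hmap : Submodule.span K (S.domRestrict '' F) ^ m =
      (Submodule.span K F ^ m).map ρ.toLinearMap := by
    rw [Submodule.map_pow, Submodule.map_span]
    rfl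
  rw [hmap]
  rintro _ ⟨x, hx, rfl⟩
  exact sum_coe_eq_zero_of_indicator_mem hF hS hx

end CoordinateSum

lemma card_le_card_image_domRestrict_mul {ι : Type*} {π : ι → Type*} (F : Finset (∀ i, π i))
    (S : Set ι) [DecidableEq (∀ i : S, π i)] [DecidableEq (∀ i : ↥Sᶜ, π i)] :
    F.card ≤ (F.image S.domRestrict).card * (F.image Sᶜ.domRestrict).card := by
  rw [← Finset.card_product]
  refine Finset.card_le_card_of_injOn (fun f ↦ (S.domRestrict f, Sᶜ.domRestrict f)) ?_ ?_
  · exact fun f hf ↦ Finset.mem_product.2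
      ⟨Finset.mem_image_of_mem _ hf, Finset.mem_image_of_mem _ hf⟩
  · intro f _ g _ hfg
    ext i
    by_cases hi : i ∈ S
    · exact congrFun (Prod.ext_iff.1 hfg).1 ⟨i, hi⟩
    · exact congrFun (Prod.ext_iff.1 hfg).2 ⟨i, hi⟩

lemma mul_one_sup_pow {K A : Type*} [CommSemiring K] [Semiring A] [Algebra K A]
    {V : Submodule K A} (hV : V ≤ V * V) (q : ℕ) : V * (1 ⊔ V) ^ q = V ^ (q + 1) := by
  induction q with
  | zero => simp
  | succ q ih =>
    have hle : V ^ (q + 1) ≤ V ^ (q + 2) := by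
      simpa only [pow_succ, mul_assoc] using mul_le_mul_right hV (V ^ q)
    rw [pow_succ, ← mul_assoc, ih, Submodule.mul_sup, mul_one, ← pow_succ, sup_eq_right.2 hle]

lemma span_le_span_mul_span {K A : Type*} [CommSemiring K] [Semiring A] [Algebra K A] {F : Set A}
    (hF : ∀ f ∈ F, IsIdempotentElem f) :
    Submodule.span K F ≤ Submodule.span K F * Submodule.span K F :=
  Submodule.span_le.2 fun f hf ↦ hF f hf ▸
    Submodule.mul_mem_mul (Submodule.subset_span hf) (Submodule.subset_span hf)

section Main

variable {ι K : Type*} [Fintype ι] [Field K] [Infinite K] {q : ℕ} [CharP K (q + 1)]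

lemma finrank_le_card_div_of_mulStabilizer_eq_bot {V : Submodule K (ι → K)} (hV : V ≤ V * V)
    (hsum : ∀ x ∈ V ^ (q + 1), ∑ i, x i = 0) (hstab : mulStabilizer ((1 ⊔ V) ^ q) = ⊥) :
    finrank K V ≤ Fintype.card ι / (q + 1) := by
  cases isEmpty_or_nonempty ι
  · simp [finrank_zero_of_subsingleton]
  have hdim : finrank K V + finrank K ↥((1 ⊔ V) ^ q) ≤ Fintype.card ι :=
    finrank_add_finrank_le_card_of_sum_eq_zero (by rwa [mul_one_sup_pow hV q])
  have hpow : q * finrank K ↥(1 ⊔ V) ≤ finrank K ↥((1 ⊔ V) ^ q) + q := by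
    have h := mul_finrank_le_finrank_pow_add (le_sup_left : 1 ≤ 1 ⊔ V) q
    rwa [hstab, Subalgebra.finrank_bot, mul_one] at h
  by_cases h1V : 1 ≤ V
  · rw [sup_eq_right.2 h1V] at hdim hpow
    have hcast : (Fintype.card ι : K) = 0 := by
      simpa using hsum 1 (Submodule.one_le.1 (one_le_pow_of_one_le' h1V (q + 1)))
    obtain ⟨t, ht⟩ := (CharP.cast_eq_zero_iff K (q + 1) _).1 hcast
    have hlt : (q + 1) * finrank K V < (q + 1) * (t + 1) := by
      linarith
    rw [ht, Nat.mul_div_cancel_left t q.succ_pos]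
    exact Nat.lt_succ_iff.1 (lt_of_mul_lt_mul_left' hlt)
  · have hlt : finrank K V + 1 ≤ finrank K ↥(1 ⊔ V) :=
      Submodule.finrank_lt_finrank_of_lt (right_lt_sup.2 h1V)
    have hmul := Nat.mul_le_mul_left q hlt
    rw [Nat.le_div_iff_mul_le q.succ_pos]
    linarith

theorem card_le_two_pow_of_sum_eq_zero {F : Finset (ι → K)} (hF : ∀ f ∈ F, IsIdempotentElem f)
    (hsum : ∀ x ∈ Submodule.span K (F : Set (ι → K)) ^ (q + 1), ∑ i, x i = 0) :
    F.card ≤ 2 ^ (Fintype.card ι / (q + 1)) := by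
  classical
  induction hn : Fintype.card ι using Nat.strong_induction_on generalizing ι with
  | _ n ih =>
  subst hn
  set V := Submodule.span K (F : Set (ι → K))
  have hV : V ≤ V * V := span_le_span_mul_span hF
  by_cases hstab : mulStabilizer ((1 ⊔ V) ^ q) = ⊥
  · exact (card_le_two_pow_finrank_span hF).trans <| Nat.pow_le_pow_right two_pos
      (finrank_le_card_div_of_mulStabilizer_eq_bot hV hsum hstab)
  · have hrestrict (T : Set ι) [Fintype T] (hT : T ≠ Set.univ)
        (hTV : T.indicator 1 ∈ mulStabilizer (V ^ (q + 1))) :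
        (F.image T.domRestrict).card ≤ 2 ^ (Fintype.card T / (q + 1)) := by
      obtain ⟨i, hi⟩ := (Set.ne_univ_iff_exists_notMem T).1 hT
      refine ih _ (Fintype.card_subtype_lt hi) ?_ ?_ rfl
      · simp only [Finset.forall_mem_image]
        exact fun f hf ↦ funext fun i ↦ congrFun (hF f hf) i
      · rw [Finset.coe_image]
        exact sum_eq_zero_of_mem_span_image_domRestrict_pow hsum hTV
    obtain ⟨S, hne, huniv, hS⟩ := exists_indicator_mem_of_subalgebra_ne_bot hstab
    have hSV : S.indicator 1 ∈ mulStabilizer (V ^ (q + 1)) := by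
      rw [← mul_one_sup_pow hV, mul_comm]
      exact mulStabilizer_le_mulStabilizer_mul _ _ hS
    have hScV : Sᶜ.indicator 1 ∈ mulStabilizer (V ^ (q + 1)) := by
      rw [Set.indicator_compl]
      exact sub_mem (one_mem _) hSV
    have hcard : Fintype.card S + Fintype.card ↥Sᶜ = Fintype.card ι := by
      rw [← Fintype.card_sum, Fintype.card_congr (Equiv.Set.sumCompl S)]
    calc F.card ≤ (F.image S.domRestrict).card * (F.image Sᶜ.domRestrict).card :=
          card_le_card_image_domRestrict_mul F S
      _ ≤ 2 ^ (Fintype.card S / (q + 1)) * 2 ^ (Fintype.card ↥Sᶜ / (q + 1)) :=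
          Nat.mul_le_mul (hrestrict S huniv hSV) (hrestrict Sᶜ (Set.compl_ne_univ.2 hne) hScV)
      _ = 2 ^ (Fintype.card S / (q + 1) + Fintype.card ↥Sᶜ / (q + 1)) := (pow_add _ _ _).symm
      _ ≤ 2 ^ (Fintype.card ι / (q + 1)) :=
          Nat.pow_le_pow_right two_pos (hcard ▸ Nat.div_add_div_le_add_div)

end Main

lemma isIdempotentElem_indicator_one {α R : Type*} [MulZeroOneClass R] (S : Set α) :
    IsIdempotentElem (S.indicator (1 : α → R)) := by
  ext i
  by_cases hi : i ∈ S <;> simp [hi]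

lemma sum_prod_indicator_eq_card_inf {α κ R : Type*} [Fintype α] [DecidableEq α] [Fintype κ]
    [CommSemiring R] (A : κ → Finset α) :
    ∑ i, ∏ k, (A k : Set α).indicator (1 : α → R) i = ((Finset.univ.inf A).card : R) := by
  have hinf : Finset.univ.inf A = Finset.univ.filter fun i ↦ ∀ k, i ∈ A k := by
    ext
    simp [Finset.mem_inf]
  simp [hinf, Set.indicator_apply, Finset.prod_ite_zero]

theorem theorem1_general {α : Type*} [Fintype α] [DecidableEq α] (p : ℕ) (hp : p.Prime)
    (F : Finset (Finset α))
    (hF : ∀ A : Fin p → Finset α, (∀ i, A i ∈ F) → p ∣ (Finset.univ.inf A).card) :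
    F.card ≤ 2 ^ (Fintype.card α / p) := by
  classical
  obtain ⟨q, rfl⟩ := Nat.exists_eq_succ_of_ne_zero hp.ne_zero
  have : Fact (q + 1).Prime := ⟨hp⟩
  let K := AlgebraicClosure (ZMod (q + 1))
  let χ : Finset α → α → K := fun A ↦ (A : Set α).indicator 1
  have hχ : Function.Injective χ := fun A B h ↦
    Finset.coe_injective (Set.indicator_one_inj K h)
  have hidem : ∀ f ∈ F.image χ, IsIdempotentElem f := by
    simp only [Finset.forall_mem_image]
    exact fun A _ ↦ isIdempotentElem_indicator_one (A : Set α)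
  have hsum : ∀ x ∈ Submodule.span K (F.image χ : Set (α → K)) ^ (q + 1), ∑ i, x i = 0 := by
    refine fun x ↦ sum_eq_zero_of_mem_span_pow fun f hf ↦ ?_
    simp only [Finset.coe_image] at hf
    choose A hA hAf using hf
    simp only [← hAf]
    exact (sum_prod_indicator_eq_card_inf A).trans
      ((CharP.cast_eq_zero_iff K (q + 1) _).2 (hF A hA))
  rw [← Finset.card_image_of_injective F hχ]
  exact card_le_two_pow_of_sum_eq_zero hidem hsum

theorem theorem1 (p : ℕ) (hp : p.Prime) (n : ℕ) (F : Finset (Finset (Fin n)))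
    (hF : KWiseDivisible p p F) : F.card ≤ 2 ^ (n / p) := by
  simpa using theorem1_general p hp F hF
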